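/- Let $R$ be a commutative Noetherian ring with $1\neq 0$, let $I$ be a proper ideal of $R$, and let $M,N$ be $R$-modules with $M$ finitely generated. For $i\ge 0$ put $$H^i_I(M,N)=\varinjlim_q \operatorname{Ext}^i_R(M/I^qM,\,N),\qquad H^i_I(N)=H^i_I(R,N),$$ where the direct system is induced by the natural maps $M/I^{q+1}M\to M/I^qM$. Put $$\operatorname{depth}_I N=\inf\{i\ge 0: H^i_I(N)\ne 0\},\qquad \operatorname{cd}_I N=\sup\{i\ge 0: H^i_I(N)\neq 0\},$$ $$h_I(M,N)=\sup_{q\ge 0}\ \sup\{i\ge 0:\operatorname{Ext}^i_R(M,H^q_I(N))\neq 0\},$$ with $\inf\emptyset=\infty$ and $\sup\emptyset=-\infty$ (so $h_I(M,N)$ may be $\pm\infty$). Assume that - $N$ is weakly Laskerian, that is, $\operatorname{Ass}_R(N/U)$ is finite for every submodule $U\subseteq N$; - $N$ is Cohen–Macaulay with respect to $I$, that is, $\operatorname{depth}_I N=\operatorname{cd}_I N$; - either $\operatorname{cd}_I N=0$ or $\operatorname{cd}_I N\ge\max\{1,\,h_I(M,N)\}$. Then $\operatorname{cd}_I N$ is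 a non-negative integer and the set $\operatorname{Ass}_R H^{\operatorname{cd}_I N}_I(M,N)$ of associated primes is finite. -/

import Mathlib

/-! Generalized local cohomology of a pair of modules over a commutative ring, the invariants
`depth_I N`, `cd_I N`, `e_R(M, N)`, `h_I(M, N)`, relative Cohen–Macaulayness and weakly
Laskerian modules. -/

universe u

namespace GenLocalCohomology



noncomputable section

open CategoryTheory

section Ext

variable (R : Type u) [CommRing R]
variable (M N : Type u) [AddCommGroup M] [Module R M] [AddCommGroup N] [Module R N]

/-- The `R`-module `Ext^i_R(M, N)`. -/
abbrev ExtMod (i : ℕ) : Type u :=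
  Abelian.Ext.{u} (ModuleCat.of R M) (ModuleCat.of R N) i

variable {M} {M' : Type u} [AddCommGroup M'] [Module R M']

/-- Contravariant functoriality of `Ext^i_R(-, N)`: a linear map `f : M → M'` induces
`Ext^i_R(M', N) → Ext^i_R(M, N)`. -/
def extMap (f : M →ₗ[R] M') (i : ℕ) : ExtMod R M' N i →ₗ[R] ExtMod R M N i :=
  (Abelian.Ext.mk₀ (ModuleCat.ofHom f)).precompOfLinear R (ModuleCat.of R N) (zero_add i)

theorem extMap_id (i : ℕ) : extMap R N (LinearMap.id : M →ₗ[R] M) i = LinearMap.id := by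
  ext x
  change (Abelian.Ext.mk₀ (ModuleCat.ofHom LinearMap.id)).comp x (zero_add i) = x
  rw [ModuleCat.ofHom_id, Abelian.Ext.mk₀_id_comp]

theorem extMap_comp {M'' : Type u} [AddCommGroup M''] [Module R M'']
    (f : M →ₗ[R] M') (g : M' →ₗ[R] M'') (i : ℕ) (x : ExtMod R M'' N i) :
    extMap R N f i (extMap R N g i x) = extMap R N (g ∘ₗ f) i x := by
  change (Abelian.Ext.mk₀ (ModuleCat.ofHom f)).comp
    ((Abelian.Ext.mk₀ (ModuleCat.ofHom g)).comp x (zero_add i)) (zero_add i) =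
    (Abelian.Ext.mk₀ (ModuleCat.ofHom (g ∘ₗ f))).comp x (zero_add i)
  rw [Abelian.Ext.mk₀_comp_mk₀_assoc, ← ModuleCat.ofHom_comp]

end Ext

section LocalCohomology

variable {R : Type u} [CommRing R] (I : Ideal R)
variable (M N : Type u) [AddCommGroup M] [Module R M] [AddCommGroup N] [Module R N]

/-- The quotient `M / I^q M`. -/
abbrev PowQuot (q : ℕ) : Type u := M ⧸ (I ^ q • (⊤ : Submodule R M))

/-- The natural map `M / I^b M → M / I^a M` for `a ≤ b`. -/
def powQuotMap (a b : ℕ) (h : a ≤ b) : PowQuot I M b →ₗ[R] PowQuot I M a :=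
  Submodule.factor (Submodule.smul_mono_left (Ideal.pow_le_pow_right h))

/-- The transition map `Ext^i_R(M / I^a M, N) → Ext^i_R(M / I^b M, N)` for `a ≤ b`. -/
def transition (i a b : ℕ) (h : a ≤ b) :
    ExtMod R (PowQuot I M a) N i →ₗ[R] ExtMod R (PowQuot I M b) N i :=
  extMap R N (powQuotMap I M a b h) i

instance directedSystem_transition (i : ℕ) :
    DirectedSystem (fun q : ℕ => ExtMod R (PowQuot I M q) N i)
      (fun a b h => transition I M N i a b h) where
  map_self a x := by
    have : powQuotMap I M a a le_rfl = LinearMap.id := by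
      ext x; simp [powQuotMap]
    change extMap R N (powQuotMap I M a a le_rfl) i x = x
    rw [this, extMap_id]; rfl
  map_map c b a hab hbc x := by
    have : powQuotMap I M a b hab ∘ₗ powQuotMap I M b c hbc =
        powQuotMap I M a c (hab.trans hbc) := by
      ext x; simp [powQuotMap]
    change extMap R N (powQuotMap I M b c hbc) i (extMap R N (powQuotMap I M a b hab) i x) =
      extMap R N (powQuotMap I M a c (hab.trans hbc)) i x
    rw [extMap_comp, this]

/-- The generalized local cohomology module
`H^i_I(M, N) = lim_{q →} Ext^i_R(M / I^q M, N)`. -/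
abbrev GenH (i : ℕ) : Type u :=
  Module.DirectLimit (fun q : ℕ => ExtMod R (PowQuot I M q) N i)
    (fun a b h => transition I M N i a b h)

/-- The local cohomology module `H^i_I(N) = H^i_I(R, N) = lim_{q →} Ext^i_R(R / I^q, N)`. -/
abbrev H (i : ℕ) : Type u := GenH I R N i

/-- `depth_I N = inf {i ≥ 0 | H^i_I(N) ≠ 0}`, with `inf ∅ = ∞`. -/
def depth : WithBot ℕ∞ := ⨅ (i : ℕ) (_ : Nontrivial (H I N i)), (i : WithBot ℕ∞)

/-- `cd_I N = sup {i ≥ 0 | H^i_I(N) ≠ 0}`, with `sup ∅ = -∞`. -/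
def cd : WithBot ℕ∞ := ⨆ (i : ℕ) (_ : Nontrivial (H I N i)), (i : WithBot ℕ∞)

/-- `N` is Cohen–Macaulay with respect to `I` if `depth_I N = cd_I N`. -/
def IsRelCohenMacaulay : Prop := depth I N = cd I N

variable (R) in
/-- `e_R(M, N) = sup {i ≥ 0 | Ext^i_R(M, N) ≠ 0}`, with `sup ∅ = -∞`. -/
def eInv : WithBot ℕ∞ := ⨆ (i : ℕ) (_ : Nontrivial (ExtMod R M N i)), (i : WithBot ℕ∞)

/-- `h_I(M, N) = sup_{q ≥ 0} e_R(M, H^q_I(N))`. -/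
def hInv : WithBot ℕ∞ := ⨆ q : ℕ, eInv R M (H I N q)

variable (R) in
/-- `N` is weakly Laskerian if `Ass_R (N / U)` is finite for every submodule `U` of `N`. -/
def IsWeaklyLaskerian : Prop := ∀ U : Submodule R N, (associatedPrimes R (N ⧸ U)).Finite

end LocalCohomology

end

end GenLocalCohomology

/-! Put `c = cd I N`. Relative Cohen–Macaulayness makes `c` a natural number with `H^i_I(N) = 0` for
`i < c`. Hence `Ext^j_R(T, N) = 0` for `j < c` and every finitely generated `T` killed by a power of
`I` (`extVanishesBelow_of_subsingleton_H`), so the transition maps defining `GenH I M N c` are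
injective. An associated prime of this limit is then the annihilator of a class at a finite stage;
it contains `I`, so the class is killed by `I` and lifts to `Ext^c_R(M/IM, N)` with the same
annihilator. That module is weakly Laskerian (`IsWeaklyLaskerian.extMod`), so it has finitely many
associated primes. -/

namespace GenLocalCohomology

open CategoryTheory

/-! ### Closure properties of weakly Laskerian modules. -/

section WeaklyLaskerian

variable {R : Type u} [CommRing R] {A B C : Type u} [AddCommGroup A] [Module R A]
  [AddCommGroup B] [Module R B] [AddCommGroup C] [Module R C]

theorem IsWeaklyLaskerian.finite_associatedPrimes (h : IsWeaklyLaskerian R A) :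
    (associatedPrimes R A).Finite := by
  rw [← LinearEquiv.AssociatedPrimes.eq (Submodule.quotEquivOfEqBot (⊥ : Submodule R A) rfl)]
  exact h ⊥

theorem IsWeaklyLaskerian.of_injective (h : IsWeaklyLaskerian R B) (f : A →ₗ[R] B)
    (hf : Function.Injective f) : IsWeaklyLaskerian R A := by
  intro U
  refine (h (U.map f)).subset (associatedPrimes.subset_of_injective
    (f := U.mapQ (U.map f) f (Submodule.le_comap_map f U)) ?_)
  rw [← LinearMap.ker_eq_bot, Submodule.ker_mapQ, Submodule.comap_map_eq_of_injective hf,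
    Submodule.mkQ_map_self]

theorem IsWeaklyLaskerian.of_surjective (h : IsWeaklyLaskerian R A) (f : A →ₗ[R] B)
    (hf : Function.Surjective f) : IsWeaklyLaskerian R B := by
  intro U
  have hg : Function.Surjective (U.mkQ ∘ₗ f) := (Submodule.mkQ_surjective U).comp hf
  rw [← LinearEquiv.AssociatedPrimes.eq ((U.mkQ ∘ₗ f).quotKerEquivOfSurjective hg)]
  exact h _

/-- Pulling `U` back along `f` and pushing it forward along `g` keeps the sequence of quotients
exact and makes its left map injective, even when `f` is not. -/
theorem IsWeaklyLaskerian.of_exact (hA : IsWeaklyLaskerian R A) (hC : IsWeaklyLaskerian R C)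
    (f : A →ₗ[R] B) (g : B →ₗ[R] C) (hfg : Function.Exact f g) : IsWeaklyLaskerian R B := by
  intro U
  let f' : (A ⧸ U.comap f) →ₗ[R] B ⧸ U := (U.comap f).mapQ U f le_rfl
  let g' : (B ⧸ U) →ₗ[R] C ⧸ U.map g := U.mapQ (U.map g) g (Submodule.le_comap_map g U)
  refine ((hA (U.comap f)).union (hC (U.map g))).subset
    (associatedPrimes.subset_union_of_exact (f := f') (g := g') ?_ ?_)
  · rw [← LinearMap.ker_eq_bot, Submodule.ker_mapQ, Submodule.mkQ_map_self]
  · rw [LinearMap.exact_iff, Submodule.ker_mapQ, Submodule.range_mapQ,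
      Submodule.comap_map_eq, Submodule.map_sup, Submodule.mkQ_map_self, bot_sup_eq,
      hfg.linearMap_ker_eq]

theorem IsWeaklyLaskerian.of_subsingleton [Subsingleton A] : IsWeaklyLaskerian R A := by
  intro U
  rw [associatedPrimes.eq_empty_of_subsingleton]
  exact Set.finite_empty

theorem IsWeaklyLaskerian.pi (h : IsWeaklyLaskerian R A) (n : ℕ) :
    IsWeaklyLaskerian R (Fin n → A) := by
  induction n with
  | zero => exact .of_subsingleton
  | succ n ih =>
    have hprod : IsWeaklyLaskerian R (A × (Fin n → A)) :=
      .of_exact h ih (LinearMap.inl R A (Fin n → A)) (LinearMap.snd R A (Fin n → A))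
        Function.Exact.inl_snd
    exact hprod.of_injective (Fin.consLinearEquiv R fun _ : Fin (n + 1) => A).symm.toLinearMap
      (LinearEquiv.injective _)

end WeaklyLaskerian

/-! ### Exactness, linearity and finiteness of Ext. -/

section Ext

variable {R : Type u} [CommRing R] {N A B C : Type u} [AddCommGroup N] [Module R N]
  [AddCommGroup A] [Module R A] [AddCommGroup B] [Module R B] [AddCommGroup C] [Module R C]

theorem shortExact_ker_subtype (f : A →ₗ[R] B) (hf : Function.Surjective f) :
    (ShortComplex.mk (ModuleCat.ofHom (LinearMap.ker f).subtype) (ModuleCat.ofHom f)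
      (by ext x; exact x.2)).ShortExact := by
  have : Mono (ModuleCat.ofHom (LinearMap.ker f).subtype) :=
    (ModuleCat.mono_iff_injective _).2 (Submodule.subtype_injective _)
  have : Epi (ModuleCat.ofHom f) := (ModuleCat.epi_iff_surjective _).2 hf
  refine { exact := (ShortComplex.moduleCat_exact_iff _).2 fun x hx => ⟨⟨x, hx⟩, rfl⟩ }

theorem exists_extMap_eq (f : A →ₗ[R] B) (hf : Function.Surjective f) (i : ℕ)
    (x : ExtMod R A N i) (hx : extMap R N (LinearMap.ker f).subtype i x = 0) :
    ∃ y, extMap R N f i y = x :=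
  Abelian.Ext.contravariant_sequence_exact₂ (shortExact_ker_subtype f hf) _ x hx

/-- The kernel of the map is the image of the connecting map from `Ext^{i-1}` of `ker f`. Writing `j
+ 1 = i` leaves no condition for `i = 0`, where Hom is left exact. -/
theorem extMap_injective (f : A →ₗ[R] B) (hf : Function.Surjective f) (i : ℕ)
    (h : ∀ j, j + 1 = i → Subsingleton (ExtMod R (LinearMap.ker f) N j)) :
    Function.Injective (extMap R N f i) := by
  rcases i with _ | i
  · have : Epi (ModuleCat.ofHom f) := (ModuleCat.epi_iff_surjective _).2 hf
    exact Abelian.Ext.precomp_mk₀_injective_of_epi (ModuleCat.of R N) (ModuleCat.ofHom f)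
  · rw [← LinearMap.ker_eq_bot, LinearMap.ker_eq_bot']
    intro x hx
    obtain ⟨y, rfl⟩ := Abelian.Ext.contravariant_sequence_exact₃ (shortExact_ker_subtype f hf)
      _ x hx (add_comm 1 i)
    have := h i rfl
    rw [Subsingleton.elim y 0, Abelian.Ext.comp_zero]

theorem extMap_sum {ι : Type*} (s : Finset ι) (f : ι → A →ₗ[R] B) (i : ℕ)
    (x : ExtMod R B N i) :
    extMap R N (∑ k ∈ s, f k) i x = ∑ k ∈ s, extMap R N (f k) i x := by
  classical
  have h0 : extMap R N (0 : A →ₗ[R] B) i x = 0 := by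
    change (Abelian.Ext.mk₀ (ModuleCat.ofHom 0)).comp x (zero_add i) = 0
    rw [ModuleCat.ofHom_zero, Abelian.Ext.mk₀_zero, Abelian.Ext.zero_comp]
  have hadd (g g' : A →ₗ[R] B) :
      extMap R N (g + g') i x = extMap R N g i x + extMap R N g' i x := by
    change (Abelian.Ext.mk₀ (ModuleCat.ofHom (g + g'))).comp x (zero_add i) = _
    rw [ModuleCat.ofHom_add, Abelian.Ext.mk₀_add, Abelian.Ext.add_comp]
    rfl
  induction s using Finset.induction_on with
  | empty => simpa using h0
  | insert a s ha ih => rw [Finset.sum_insert ha, Finset.sum_insert ha, hadd, ih]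

theorem extMap_smul (r : R) (f : A →ₗ[R] B) (i : ℕ) (x : ExtMod R B N i) :
    extMap R N (r • f) i x = r • extMap R N f i x := by
  change (Abelian.Ext.mk₀ (ModuleCat.ofHom (r • f))).comp x (zero_add i) = _
  have : ModuleCat.ofHom (r • f) = r • ModuleCat.ofHom f := rfl
  rw [this, Abelian.Ext.mk₀_smul, Abelian.Ext.smul_comp]
  rfl

theorem subsingleton_extMod_pi (i n : ℕ) (h : Subsingleton (ExtMod R A N i)) :
    Subsingleton (ExtMod R (Fin n → A) N i) := by
  refine subsingleton_of_forall_eq 0 fun x => ?_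
  have hid : (LinearMap.id : (Fin n → A) →ₗ[R] Fin n → A) =
      ∑ k, LinearMap.single R (fun _ => A) k ∘ₗ LinearMap.proj k := by
    ext k a j
    simp
  rw [← LinearMap.id_apply (R := R) x, ← extMap_id, hid, extMap_sum]
  refine Finset.sum_eq_zero fun k _ => ?_
  rw [← extMap_comp, Subsingleton.elim (extMap R N _ i x) 0, map_zero]

theorem smul_eq_zero_of_forall_smul_eq_zero (r : R) (h : ∀ a : A, r • a = 0) (i : ℕ)
    (x : ExtMod R A N i) : r • x = 0 := by
  have h0 : r • (LinearMap.id : A →ₗ[R] A) = 0 := by ext a; exact h a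
  have := extMap_smul r LinearMap.id i x
  rw [extMap_id, LinearMap.id_apply] at this
  rw [← this, h0]
  simpa using extMap_sum (R := R) (∅ : Finset ℕ) (fun _ => (0 : A →ₗ[R] A)) i x

/-- Dimension shifting along a surjection from a free module `R^n` onto `T`: `Hom(T, N)` embeds in
`N^n`, and `Ext^{i+1}(T, N)` is a quotient of `Ext^i` of the kernel, which is finitely generated
because `R` is Noetherian. -/
theorem IsWeaklyLaskerian.extMod [IsNoetherianRing R] (hN : IsWeaklyLaskerian R N) (i : ℕ)
    (T : Type u) [AddCommGroup T] [Module R T] [Module.Finite R T] :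
    IsWeaklyLaskerian R (ExtMod R T N i) := by
  induction i generalizing T with
  | zero =>
    obtain ⟨n, f, hf⟩ := Module.Finite.exists_fin' R T
    let e : (T →ₗ[R] N) →ₗ[R] Fin n → N :=
      (LinearMap.funLeft R N fun k : Fin n => f (Pi.single k 1)) ∘ₗ LinearMap.ltoFun R T N R
    let e₀ : ExtMod R T N 0 ≃ₗ[R] (T →ₗ[R] N) :=
      Abelian.Ext.linearEquiv₀ (R := R) ≪≫ₗ ModuleCat.homLinearEquiv (S := R)
    refine (hN.pi n).of_injective (e ∘ₗ e₀.toLinearMap)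
      (Function.Injective.comp (g := e) ?_ e₀.injective)
    intro g g' hgg
    refine (LinearMap.cancel_right hf).1 ((Pi.basisFun R (Fin n)).ext fun k => ?_)
    simpa [e] using congrFun hgg k
  | succ i ih =>
    obtain ⟨n, f, hf⟩ := Module.Finite.exists_fin' R T
    let S := shortExact_ker_subtype f hf
    refine (ih (LinearMap.ker f)).of_surjective
      (S.extClass.precompOfLinear R (ModuleCat.of R N) (add_comm 1 i)) fun x => ?_
    have : Projective (ModuleCat.of R (Fin n → R)) :=
      (IsProjective.iff_projective _).1 inferInstance
    exact Abelian.Ext.contravariant_sequence_exact₃ S _ x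
      (Abelian.Ext.eq_zero_of_projective _) (add_comm 1 i)

end Ext

/-! ### Vanishing below degree `c` and its consequences in degree `c`. -/

section Vanishing

variable {R : Type u} [CommRing R] {I : Ideal R} {N : Type u} [AddCommGroup N] [Module R N]

theorem smul_powQuot_eq_zero (M : Type u) [AddCommGroup M] [Module R M] (q : ℕ) {r : R}
    (hr : r ∈ I ^ q) (x : PowQuot I M q) : r • x = 0 := by
  obtain ⟨m, rfl⟩ := Submodule.mkQ_surjective _ x
  rw [← map_smul, Submodule.mkQ_apply, Submodule.Quotient.mk_eq_zero]
  exact Submodule.smul_mem_smul hr trivial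

theorem powQuotMap_surjective (M : Type u) [AddCommGroup M] [Module R M] (a b : ℕ)
    (h : a ≤ b) : Function.Surjective (powQuotMap I M a b h) :=
  Submodule.factor_surjective (Submodule.smul_mono_left (Ideal.pow_le_pow_right h))

theorem of_injective_of_transition_injective {M : Type u} [AddCommGroup M] [Module R M] {i : ℕ}
    (h : ∀ a b hab, Function.Injective (transition I M N i a b hab)) (q : ℕ) :
    Function.Injective (Module.DirectLimit.of R ℕ
      (fun q : ℕ => ExtMod R (PowQuot I M q) N i) (fun a b h => transition I M N i a b h) q) := by
  rw [← LinearMap.ker_eq_bot, LinearMap.ker_eq_bot']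
  intro x hx
  obtain ⟨b, hab, hb⟩ := Module.DirectLimit.of.zero_exact hx
  exact (map_eq_zero_iff _ (h q b hab)).1 hb

variable (I N) in
/-- `Ext^j_R(T, N) = 0` for all `j < i` and all finitely generated modules `T` annihilated by a
power of `I`. -/
def ExtVanishesBelow (i : ℕ) : Prop :=
  ∀ j < i, ∀ (k : ℕ) (T : Type u) [AddCommGroup T] [Module R T] [Module.Finite R T],
    (∀ r ∈ I ^ k, ∀ t : T, r • t = 0) → Subsingleton (ExtMod R T N j)

variable [IsNoetherianRing R]

theorem extMap_injective_of_pow_torsion {A B : Type u} [AddCommGroup A] [Module R A]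
    [AddCommGroup B] [Module R B] [Module.Finite R A] {i : ℕ}
    (hV : ExtVanishesBelow I N i)
    (k : ℕ) (hA : ∀ r ∈ I ^ k, ∀ a : A, r • a = 0) (f : A →ₗ[R] B)
    (hf : Function.Surjective f) : Function.Injective (extMap R N f i) :=
  extMap_injective f hf i fun j hj =>
    hV j (by omega) k _ fun r hr t => Subtype.ext (hA r hr t)

theorem transition_injective (M : Type u) [AddCommGroup M] [Module R M] [Module.Finite R M] {i : ℕ}
    (hV : ExtVanishesBelow I N i)
    (a b : ℕ) (hab : a ≤ b) : Function.Injective (transition I M N i a b hab) :=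
  extMap_injective_of_pow_torsion hV b (fun _ hr => smul_powQuot_eq_zero M b hr) _
    (powQuotMap_surjective M a b hab)

/-- If `H^i_I(N) = 0` for all `i < c`, then `Ext^i_R(T, N) = 0` for all `i < c` and all finitely
generated modules `T` annihilated by a power of `I`. -/
theorem extVanishesBelow_of_subsingleton_H {c : ℕ} (h : ∀ i < c, Subsingleton (H I N i)) :
    ExtVanishesBelow I N c := by
  intro i hi k T _ _ _ hT
  induction i using Nat.strong_induction_on generalizing k T with
  | _ i ih =>
    have hV : ExtVanishesBelow I N i :=
      fun j hj k T _ _ _ hT => ih j hj (hj.trans hi) k T hT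
    have := h i hi
    -- By induction the transition maps in degree `i` are injective, so this Ext embeds in `H I N i
    -- = 0`.
    have hcyc : Subsingleton (ExtMod R (PowQuot I R k) N i) :=
      (of_injective_of_transition_injective (transition_injective R hV) k).subsingleton
    obtain ⟨n, f, hf⟩ := Module.Finite.exists_fin' R T
    have hle : I ^ k • (⊤ : Submodule R R) ≤ Module.annihilator R T := by
      refine Submodule.smul_le.2 fun r hr s _ => Module.mem_annihilator.2 fun t => ?_
      rw [smul_eq_mul, mul_smul, hT r hr]
    let g (t : T) : PowQuot I R k →ₗ[R] T :=
      (I ^ k • (⊤ : Submodule R R)).liftQ (LinearMap.toSpanSingleton R T t)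
        fun r hr => Module.mem_annihilator.1 (hle hr) t
    -- `T` is a quotient of `(R/I^k)^n`, so its `Ext^i` embeds in one that vanishes.
    let G : (Fin n → PowQuot I R k) →ₗ[R] T :=
      LinearMap.lsum R (fun _ : Fin n => PowQuot I R k) R fun j => g (f (Pi.single j 1))
    have hG : Function.Surjective G := by
      intro t
      obtain ⟨v, rfl⟩ := hf t
      refine ⟨fun j => Submodule.Quotient.mk (v j), ?_⟩
      conv_rhs => rw [LinearMap.pi_apply_eq_sum_univ f v]
      simp only [G, LinearMap.lsum_apply, LinearMap.sum_apply, LinearMap.comp_apply,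
        LinearMap.proj_apply]
      refine Finset.sum_congr rfl fun j _ => ?_
      change v j • f (Pi.single j 1) = _
      congr 2
      ext l
      simp [Pi.single_apply, eq_comm]
    have := subsingleton_extMod_pi (N := N) i n hcyc
    have htors (r : R) (hr : r ∈ I ^ k) (v : Fin n → PowQuot I R k) : r • v = 0 :=
      funext fun j => smul_powQuot_eq_zero R k hr (v j)
    exact (extMap_injective_of_pow_torsion hV k htors G hG).subsingleton

/-- A class in `Ext^i_R(T, N)` annihilated by `I` comes from `Ext^i_R(T / IT, N)`, provided that
`Ext^j_R(-, N)` vanishes on finitely generated modules annihilated by a power of `I` for `j < i`. -/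
theorem exists_extMap_eq_of_smul_eq_zero {T T' : Type u} [AddCommGroup T] [Module R T]
    [AddCommGroup T'] [Module R T'] [Module.Finite R T] {i : ℕ}
    (hV : ExtVanishesBelow I N i)
    (k : ℕ) (hT : ∀ r ∈ I ^ k, ∀ t : T, r • t = 0) (g : T →ₗ[R] T')
    (hg : Function.Surjective g) (hker : LinearMap.ker g = I • ⊤) (x : ExtMod R T N i)
    (hx : ∀ r ∈ I, r • x = 0) : ∃ y, extMap R N g i y = x := by
  refine exists_extMap_eq g hg i x ?_
  obtain ⟨n, a, ha⟩ := Submodule.fg_iff_exists_fin_generating_family.1 (IsNoetherian.noetherian I)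
  have haI (j : Fin n) : a j ∈ I := ha ▸ Submodule.subset_span ⟨j, rfl⟩
  -- With `a` generating `I`, `F` maps `T^n` onto `IT = ker g`. Restricting `x` to `IT` can be
  -- tested on `T^n`, where it becomes a sum of pullbacks of `a j • x = 0`.
  let F : (Fin n → T) →ₗ[R] T := ∑ j, a j • LinearMap.proj j
  have hFapp (v : Fin n → T) : F v = ∑ j, a j • v j := by simp [F, LinearMap.sum_apply]
  have hF (v : Fin n → T) : F v ∈ LinearMap.ker g := by
    rw [hker, hFapp]
    exact Submodule.sum_mem _ fun j _ => Submodule.smul_mem_smul (haI j) trivial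
  have hsurj : Function.Surjective (F.codRestrict _ hF) := by
    have hle : LinearMap.ker g ≤ LinearMap.range F := by
      rw [hker, Submodule.smul_le]
      intro r hr t _
      rw [← ha, Submodule.mem_span_range_iff_exists_fun] at hr
      obtain ⟨b, rfl⟩ := hr
      refine ⟨fun j => b j • t, ?_⟩
      rw [hFapp, Finset.sum_smul]
      exact Finset.sum_congr rfl fun j _ => by rw [smul_smul, smul_eq_mul, mul_comm]
    rintro ⟨t, ht⟩
    obtain ⟨v, hv⟩ := hle ht
    exact ⟨v, Subtype.ext hv⟩
  have htors (r : R) (hr : r ∈ I ^ k) (v : Fin n → T) : r • v = 0 :=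
    funext fun j => hT r hr (v j)
  refine extMap_injective_of_pow_torsion hV k htors _ hsurj ?_
  rw [extMap_comp, LinearMap.subtype_comp_codRestrict, map_zero, extMap_sum]
  refine Finset.sum_eq_zero fun j _ => ?_
  rw [extMap_smul, ← map_smul, hx _ (haI j), map_zero]

theorem associatedPrimes_genH_subset (M : Type u) [AddCommGroup M] [Module R M]
    [Module.Finite R M] {c : ℕ} (h : ∀ i < c, Subsingleton (H I N i)) :
    associatedPrimes R (GenH I M N c) ⊆ associatedPrimes R (ExtMod R (PowQuot I M 1) N c) := by
  intro p hp
  obtain ⟨hprime, z, hz⟩ := isAssociatedPrime_iff.1 hp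
  have hV := extVanishesBelow_of_subsingleton_H h
  -- Stage `q + 1` rather than `q` guarantees a map onto `M/IM`.
  obtain ⟨q, x, rfl⟩ : ∃ q x, Module.DirectLimit.of R ℕ
      (fun q : ℕ => ExtMod R (PowQuot I M q) N c) (fun a b h => transition I M N c a b h)
      (q + 1) x = z := by
    obtain ⟨q, x, rfl⟩ := Module.DirectLimit.exists_of z
    exact ⟨q, transition I M N c q (q + 1) q.le_succ x,
      Module.DirectLimit.of_f (f := fun a b h => transition I M N c a b h)⟩
  have hpx (r : R) : r ∈ p ↔ r • x = 0 := by
    rw [hz, Submodule.mem_colon_singleton, Submodule.mem_bot, ← map_smul,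
      map_eq_zero_iff _
        (of_injective_of_transition_injective (transition_injective M hV) (q + 1))]
  have hle : I ≤ p := hprime.le_of_pow_le (n := q + 1) fun r hr =>
    (hpx r).2 (smul_eq_zero_of_forall_smul_eq_zero r (smul_powQuot_eq_zero M _ hr) c x)
  have hker : LinearMap.ker (powQuotMap I M 1 (q + 1) (by omega)) = I • ⊤ := by
    rw [powQuotMap, Submodule.factor, Submodule.ker_mapQ, Submodule.comap_id, pow_one,
      Submodule.map_smul'', Submodule.map_top, Submodule.range_mkQ]
  obtain ⟨y, rfl⟩ := exists_extMap_eq_of_smul_eq_zero hV (q + 1)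
    (fun _ hr => smul_powQuot_eq_zero M _ hr) (powQuotMap I M 1 (q + 1) (by omega))
    (powQuotMap_surjective M _ _ _) hker x fun r hr => (hpx r).1 (hle hr)
  refine isAssociatedPrime_iff.2 ⟨hprime, y, Ideal.ext fun r => ?_⟩
  rw [hpx, Submodule.mem_colon_singleton, Submodule.mem_bot, ← map_smul]
  exact map_eq_zero_iff _ (transition_injective M hV 1 (q + 1) (by omega))

end Vanishing

theorem exists_cd_eq_of_isRelCohenMacaulay {R : Type u} [CommRing R] {I : Ideal R} {N : Type u}
    [AddCommGroup N] [Module R N] (h : IsRelCohenMacaulay I N) :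
    ∃ c : ℕ, cd I N = c ∧ ∀ i < c, Subsingleton (H I N i) := by
  by_cases hne : ∃ c, Nontrivial (H I N c)
  · obtain ⟨c, hc⟩ := hne
    have hle (i : ℕ) (hi : Nontrivial (H I N i)) : depth I N ≤ i := iInf₂_le i hi
    have hge (i : ℕ) (hi : Nontrivial (H I N i)) : (i : WithBot ℕ∞) ≤ cd I N :=
      le_iSup₂_of_le i hi le_rfl
    refine ⟨c, le_antisymm (h ▸ hle c hc) (hge c hc), fun i hi => ?_⟩
    by_contra hi'
    have := (hge c hc).trans (h ▸ hle i (not_subsingleton_iff_nontrivial.1 hi'))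
    exact absurd (by exact_mod_cast this : c ≤ i) (by omega)
  -- If all `H^i_I(N)` vanish, depth is `⊤` and `cd` is `⊥`, which contradicts their equality.
  · push Not at hne
    exfalso
    have hdepth : depth I N = ⊤ :=
      iInf₂_eq_top.2 fun i hi => absurd hi (not_nontrivial_iff_subsingleton.2 (hne i))
    have hcd : cd I N = ⊥ :=
      iSup₂_eq_bot.2 fun i hi => absurd hi (not_nontrivial_iff_subsingleton.2 (hne i))
    rw [IsRelCohenMacaulay, hdepth, hcd] at h
    exact top_ne_bot h

end GenLocalCohomology

theorem corollary2p8 {R : Type u} [CommRing R] [IsNoetherianRing R] (I : Ideal R) (hI : I ≠ ⊤)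
    (M N : Type u) [AddCommGroup M] [Module R M] [AddCommGroup N] [Module R N]
    (hM : Module.Finite R M) (hN : GenLocalCohomology.IsWeaklyLaskerian R N)
    (hCM : GenLocalCohomology.IsRelCohenMacaulay I N)
    (h : GenLocalCohomology.cd I N = 0 ∨
      max 1 (GenLocalCohomology.hInv I M N) ≤ GenLocalCohomology.cd I N) :
    ∃ c : ℕ, GenLocalCohomology.cd I N = (c : WithBot ℕ∞) ∧
      (associatedPrimes R (GenLocalCohomology.GenH I M N c)).Finite := by
  obtain ⟨c, hc, hvan⟩ := GenLocalCohomology.exists_cd_eq_of_isRelCohenMacaulay hCM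
  exact ⟨c, hc, (hN.extMod c _).finite_associatedPrimes.subset
    (GenLocalCohomology.associatedPrimes_genH_subset M hvan)⟩
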